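/- Let $G$ be a topological group and let $A$, $B$ be C$^*$-algebras (not necessarily unital) with point-norm continuous actions $\alpha:G\to\operatorname{Aut}(A)$ and $\beta:G\to\operatorname{Aut}(B)$ by $*$-automorphisms. Let $\phi:A\to B$ be a completely positive contractive linear map which has order zero (that is, $\phi(a)\phi(b)=0$ whenever $a,b\in A_+$ and $ab=0$) and is equivariant (that is, $\phi\circ\alpha_g=\beta_g\circ\phi$ for all $g\in G$). Let $C_\phi:=C^*(\phi(A))\subseteq B$ be the C$^*$-subalgebra generated by the image of $\phi$, let $\mathcal M(C_\phi)$ be its multiplier algebra, regarded as a subset of $B^{**}$ through the canonical embeddings $\mathcal M(C_\phi)\subseteq C_\phi^{**}\subseteq B^{**}$, and let $\beta_g^{**}:B^{**}\to B^{**}$ be the bidual map of $\beta_g$. Then the maps $\beta_g^{**}$, $g\in G$, restrict to an action of $G$ on $\mathcal M(C_\phi)$ by $*$-automorphisms, and there exist a positive element $h_\phi\in\mathcal M(C_\phi)$ and a $*$-homomorphism $\pi_\phi:A\to\mathcal M(C_\phi)$ such that 1. $h_\phi$ is $G$-invariant, i.e. $\beta_g^{**}(h_\phi)=h_\phi$ for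 all $g\in G$; $h_\phi$ commutes with every element of $C_\phi$; and $\|h_\phi\|=\|\phi\|$; 2. $\pi_\phi$ is non-degenerate, i.e. the linear span of $\pi_\phi(A)C_\phi$ is dense in $C_\phi$; every $\pi_\phi(a)$, $a\in A$, commutes with $h_\phi$; and $\beta_g^{**}\circ\pi_\phi=\pi_\phi\circ\alpha_g$ for all $g\in G$; 3. $\phi(a)=h_\phi\pi_\phi(a)$ for all $a\in A$. -/

import Mathlib

open Filter Topology
open scoped CStarAlgebra MultiplierAlgebra

/-- The C⋆-subalgebra `C*(S)` of `B` generated by a subset `S`. -/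
noncomputable def cstarGenerated {B : Type*} [NonUnitalCStarAlgebra B] (S : Set B) :
    NonUnitalStarSubalgebra ℂ B :=
  (NonUnitalStarAlgebra.adjoin ℂ S).topologicalClosure

instance cstarGenerated_isClosed {B : Type*} [NonUnitalCStarAlgebra B] (S : Set B) :
    IsClosed (cstarGenerated S : Set B) :=
  NonUnitalStarSubalgebra.isClosed_topologicalClosure _

theorem subset_cstarGenerated {B : Type*} [NonUnitalCStarAlgebra B] (S : Set B) :
    S ⊆ cstarGenerated S :=
  (NonUnitalStarAlgebra.subset_adjoin ℂ S).trans
    (NonUnitalStarSubalgebra.le_topologicalClosure (NonUnitalStarAlgebra.adjoin ℂ S))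

/-- The usual order of a C⋆-algebra, on the multiplier algebra: `x ≤ y` if and only if `y - x` is
self-adjoint with spectrum in `[0, ∞)`. -/
noncomputable instance multiplierPartialOrder {C : Type*} [NonUnitalCStarAlgebra C] :
    PartialOrder 𝓜(ℂ, C) :=
  CStarAlgebra.spectralOrder _

instance multiplierStarOrderedRing {C : Type*} [NonUnitalCStarAlgebra C] :
    StarOrderedRing 𝓜(ℂ, C) :=
  CStarAlgebra.spectralOrderedRing _

/-- The canonical approximate unit of a C⋆-algebra `C`: the positive elements of the closed unit
ball, directed upwards along the positive elements of the open unit ball. -/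
noncomputable def canonicalApproximateUnit (C : Type*) [NonUnitalCStarAlgebra C] : Filter C :=
  letI : PartialOrder C := CStarAlgebra.spectralOrder C
  letI : StarOrderedRing C := CStarAlgebra.spectralOrderedRing C
  CStarAlgebra.approximateUnit C

/-- The Banach space bidual `B**`. -/
abbrev Bidual (B : Type*) [NonUnitalCStarAlgebra B] : Type _ :=
  StrongDual ℂ (StrongDual ℂ B)

/-- The bidual map (double transpose) `T** : B₁** → B₂**` of a bounded linear map `T : B₁ → B₂`,
that is `T**(x)(f) = x(f ∘ T)`. -/
noncomputable def bidualMap {B₁ B₂ : Type*} [NonUnitalCStarAlgebra B₁] [NonUnitalCStarAlgebra B₂]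
    (T : B₁ →L[ℂ] B₂) : Bidual B₁ →L[ℂ] Bidual B₂ :=
  ContinuousLinearMap.precomp ℂ (ContinuousLinearMap.precomp ℂ T)

theorem bidualMap_apply {B₁ B₂ : Type*} [NonUnitalCStarAlgebra B₁] [NonUnitalCStarAlgebra B₂]
    (T : B₁ →L[ℂ] B₂) (x : Bidual B₁) (f : StrongDual ℂ B₂) :
    bidualMap T x f = x (f ∘L T) :=
  rfl

/-- A `*`-automorphism of a C⋆-algebra, as a bounded linear map. -/
noncomputable def autToCLM {B : Type*} [NonUnitalCStarAlgebra B] (β : B ≃⋆ₐ[ℂ] B) : B →L[ℂ] B :=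
  LinearMap.mkContinuous
    { toFun := β, map_add' := map_add β, map_smul' := map_smul β } 1
    (fun b => by
      rw [one_mul]
      exact NonUnitalStarAlgHom.norm_apply_le (F := B ≃⋆ₐ[ℂ] B) β b)

theorem autToCLM_apply {B : Type*} [NonUnitalCStarAlgebra B] (β : B ≃⋆ₐ[ℂ] B) (b : B) :
    autToCLM β b = β b :=
  rfl

/-- A contractive completely positive map, as a bounded linear map; its norm is the operator
norm. -/
noncomputable def cpcToCLM {A B : Type*} [NonUnitalCStarAlgebra A] [PartialOrder A]
    [StarOrderedRing A] [NonUnitalCStarAlgebra B] [PartialOrder B] [StarOrderedRing B]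
    (φ : A →CP B) (hφ : ∀ a, ‖φ a‖ ≤ ‖a‖) : A →L[ℂ] B :=
  LinearMap.mkContinuous φ.toLinearMap 1 (fun a => by rw [one_mul]; exact hφ a)

section BidualEmbedding

theorem canonicalApproximateUnit_neBot (C : Type*) [NonUnitalCStarAlgebra C] :
    (canonicalApproximateUnit C).NeBot := by
  let _ : PartialOrder C := CStarAlgebra.spectralOrder C
  let _ : StarOrderedRing C := CStarAlgebra.spectralOrderedRing C
  exact (CStarAlgebra.increasingApproximateUnit C).neBot

theorem canonicalApproximateUnit_tendsto (C : Type*) [NonUnitalCStarAlgebra C] (c : C) :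
    Tendsto (fun e => e * c) (canonicalApproximateUnit C) (𝓝 c) := by
  let _ : PartialOrder C := CStarAlgebra.spectralOrder C
  let _ : StarOrderedRing C := CStarAlgebra.spectralOrderedRing C
  exact (CStarAlgebra.increasingApproximateUnit C).tendsto_mul_right c

theorem canonicalApproximateUnit_tendsto_left (C : Type*) [NonUnitalCStarAlgebra C] (c : C) :
    Tendsto (fun e => c * e) (canonicalApproximateUnit C) (𝓝 c) := by
  let _ : PartialOrder C := CStarAlgebra.spectralOrder C
  let _ : StarOrderedRing C := CStarAlgebra.spectralOrderedRing C
  exact (CStarAlgebra.increasingApproximateUnit C).tendsto_mul_left c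

theorem canonicalApproximateUnit_eventually (C : Type*) [NonUnitalCStarAlgebra C] :
    ∀ᶠ e in canonicalApproximateUnit C, star e = e ∧ ‖e‖ ≤ 1 := by
  let _ : PartialOrder C := CStarAlgebra.spectralOrder C
  let _ : StarOrderedRing C := CStarAlgebra.spectralOrderedRing C
  exact (CStarAlgebra.increasingApproximateUnit C).eventually_star_eq.and
    (CStarAlgebra.increasingApproximateUnit C).eventually_norm

theorem functional_approx_left {C : Type*} [NonUnitalCStarAlgebra C] (g : StrongDual ℂ C)
    {ε : ℝ} (hε : 0 < ε) :
    ∀ᶠ e in canonicalApproximateUnit C, ∀ y : C, ‖y‖ ≤ 1 → ‖g (y - e * y)‖ ≤ ε := by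
  set N := ‖g‖ with hN
  have hN0 : 0 ≤ N := norm_nonneg g
  set t := ε / (1 + 3 * N) with ht
  have ht0 : 0 < t := by positivity
  obtain ⟨c, hc1, hc2⟩ : ∃ c : C, ‖c‖ ≤ 1 ∧ N - t ^ 2 ≤ ‖g c‖ := by
    obtain ⟨c, hc1, hc2⟩ := g.exists_lt_apply_of_lt_opNorm (r := N - t ^ 2)
      (by rw [← hN]; nlinarith)
    exact ⟨c, hc1.le, hc2.le⟩
  have hev : ∀ᶠ e in canonicalApproximateUnit C, ‖e * c - c‖ < t := by
    have := (canonicalApproximateUnit_tendsto C c)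
    rw [tendsto_iff_norm_sub_tendsto_zero] at this
    exact this.eventually_lt_const ht0
  filter_upwards [hev, canonicalApproximateUnit_eventually C] with e he ⟨hes, hen⟩ y hy
  set z := y - e * y with hz
  have hzn : ‖z‖ ≤ 2 := by
    calc ‖z‖ ≤ ‖y‖ + ‖e * y‖ := norm_sub_le _ _
      _ ≤ ‖y‖ + ‖e‖ * ‖y‖ := by gcongr; exact norm_mul_le _ _
      _ ≤ 2 := by nlinarith [norm_nonneg y, norm_nonneg e]
  have hzc : ‖star z * c‖ ≤ t := by
    have : star z * c = star y * -(e * c - c) := by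
      rw [hz, star_sub, star_mul, hes]; noncomm_ring
    rw [this]
    calc _ ≤ ‖star y‖ * ‖-(e * c - c)‖ := norm_mul_le _ _
      _ ≤ 1 * t := by rw [norm_star, norm_neg]; gcongr
      _ = t := one_mul t
  obtain ⟨s, hs, hsg⟩ : ∃ s : ℂ, ‖s‖ = t ∧ ‖g c + s * g z‖ = ‖g c‖ + t * ‖g z‖ := by
    obtain ⟨a, ha, ha'⟩ := Complex.exists_norm_eq_mul_self (g c)
    obtain ⟨b, hb, hb'⟩ := Complex.exists_norm_eq_mul_self (g z)
    have ha0 : a ≠ 0 := by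
      rintro rfl
      simp at ha
    refine ⟨t * b * a⁻¹, by simp [ha, hb, abs_of_pos ht0], ?_⟩
    have : g c + t * b * a⁻¹ * g z = a⁻¹ * ((‖g c‖ + t * ‖g z‖ : ℝ) : ℂ) := by
      push_cast
      rw [ha', hb']
      field_simp
    rw [this, norm_mul, norm_inv, ha, inv_one, one_mul, Complex.norm_real,
      Real.norm_of_nonneg (by positivity)]
  have hcz : ‖c + s • z‖ ≤ 1 + 3 * t ^ 2 := by
    have h1 : ‖c + s • z‖ * ‖c + s • z‖ ≤ 1 + 6 * t ^ 2 := by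
      rw [← CStarRing.norm_star_mul_self]
      have : star (c + s • z) * (c + s • z) = star c * c + s • star (star z * c)
          + star s • (star z * c) + (star s * s) • (star z * z) := by
        simp only [star_add, star_smul, add_mul, mul_add, smul_mul_assoc, mul_smul_comm,
          smul_add, mul_smul, star_mul, star_star, smul_comm s (star s)]
        abel
      rw [this]
      have e1 : ‖star c * c‖ ≤ 1 := by
        rw [CStarRing.norm_star_mul_self]; nlinarith [norm_nonneg c]
      have e2 : ‖s • star (star z * c)‖ ≤ t * t := by
        rw [norm_smul, norm_star, hs]; gcongr
      have e3 : ‖star s • (star z * c)‖ ≤ t * t := by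
        rw [norm_smul, norm_star, hs]; gcongr
      have e4 : ‖(star s * s) • (star z * z)‖ ≤ (t * t) * 4 := by
        rw [norm_smul, norm_mul, norm_star, hs, CStarRing.norm_star_mul_self]
        gcongr
        nlinarith [norm_nonneg z]
      calc _ ≤ ‖star c * c‖ + ‖s • star (star z * c)‖ + ‖star s • (star z * c)‖
            + ‖(star s * s) • (star z * z)‖ := norm_add₄_le
        _ ≤ _ := by nlinarith
    nlinarith [norm_nonneg (c + s • z), sq_nonneg (t ^ 2), sq_nonneg t]
  have hg : ‖g c‖ + t * ‖g z‖ ≤ N * (1 + 3 * t ^ 2) := by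
    rw [← hsg]
    calc ‖g c + s * g z‖ = ‖g (c + s • z)‖ := by simp
      _ ≤ N * ‖c + s • z‖ := g.le_opNorm _
      _ ≤ _ := by gcongr
  have : t * ‖g z‖ ≤ t * (t * (1 + 3 * N)) := by nlinarith
  have h2 := le_of_mul_le_mul_left this ht0
  rwa [ht, div_mul_cancel₀ _ (by positivity)] at h2

theorem functional_approx_right {C : Type*} [NonUnitalCStarAlgebra C] (g : StrongDual ℂ C)
    {ε : ℝ} (hε : 0 < ε) :
    ∀ᶠ e in canonicalApproximateUnit C, ∀ y : C, ‖y‖ ≤ 1 → ‖g (y - y * e)‖ ≤ ε := by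
  let g' : StrongDual ℂ C := LinearMap.mkContinuous
    { toFun := fun y => star (g (star y))
      map_add' := fun x y => by simp
      map_smul' := fun k y => by simp } ‖g‖
    (fun y => by
      change ‖star (g (star y))‖ ≤ _
      rw [norm_star, ← norm_star y]
      exact g.le_opNorm _)
  filter_upwards [functional_approx_left g' hε, canonicalApproximateUnit_eventually C]
    with e he ⟨hes, _⟩ y hy
  have h1 : ‖star (g (star (star y - e * star y)))‖ ≤ ε := he (star y) (by rwa [norm_star])
  rwa [norm_star, star_sub, star_mul, star_star, hes] at h1

theorem functional_tendsto {C : Type*} [NonUnitalCStarAlgebra C] (g : StrongDual ℂ C) :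
    ∃ L : ℂ, Tendsto (fun e => g e) (canonicalApproximateUnit C) (𝓝 L) := by
  have := canonicalApproximateUnit_neBot C
  rw [← cauchy_map_iff_exists_tendsto, Metric.cauchy_iff]
  refine ⟨inferInstance, fun ε hε => ?_⟩
  have h := (functional_approx_left g (ε := ε / 3) (by positivity)).and
    ((functional_approx_right g (ε := ε / 3) (by positivity)).and
      (canonicalApproximateUnit_eventually C))
  refine ⟨_, image_mem_map h, ?_⟩
  rintro _ ⟨e, ⟨hel, -, -, hen⟩, rfl⟩ _ ⟨d, ⟨-, hdr, -, hdn⟩, rfl⟩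
  have h1 := hel d hdn
  have h2 := hdr e hen
  calc dist (g e) (g d) = ‖g (e - e * d) - g (d - e * d)‖ := by
        rw [dist_eq_norm]; simp
    _ ≤ ‖g (e - e * d)‖ + ‖g (d - e * d)‖ := norm_sub_le _ _
    _ < ε := by linarith

end BidualEmbedding

section

variable {B : Type*} [NonUnitalCStarAlgebra B] (C : NonUnitalStarSubalgebra ℂ B)
  [IsClosed (C : Set B)]

/-- The bounded functional `e ↦ f (m e)` on `C`, for `m ∈ M(C)` and `f ∈ B*`. -/
noncomputable def multiplierFunctional (m : 𝓜(ℂ, C)) (f : StrongDual ℂ B) : StrongDual ℂ C :=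
  LinearMap.mkContinuous
    { toFun := fun e => f (m.fst e : B)
      map_add' := fun x y => by simp
      map_smul' := fun k y => by simp } (‖f‖ * ‖m‖)
    (fun e => by
      change ‖f (m.fst e : B)‖ ≤ _
      rw [mul_assoc]
      refine (f.le_opNorm _).trans (mul_le_mul_of_nonneg_left ?_ (norm_nonneg f))
      rw [← DoubleCentralizer.norm_fst m]
      exact m.fst.le_opNorm e)

/-- The value at `f ∈ B*` of the image of `m ∈ M(C)` in `B**`. -/
noncomputable def multiplierToBidualFun (m : 𝓜(ℂ, C)) (f : StrongDual ℂ B) : ℂ :=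
  limUnder (canonicalApproximateUnit C) (fun e : C => f (m.fst e : B))

theorem multiplierToBidualFun_tendsto (m : 𝓜(ℂ, C)) (f : StrongDual ℂ B) :
    Tendsto (fun e : C => f (m.fst e : B)) (canonicalApproximateUnit C)
      (𝓝 (multiplierToBidualFun C m f)) :=
  tendsto_nhds_limUnder (functional_tendsto (multiplierFunctional C m f))

theorem multiplierToBidualFun_add_right (m : 𝓜(ℂ, C)) (f₁ f₂ : StrongDual ℂ B) :
    multiplierToBidualFun C m (f₁ + f₂) =
      multiplierToBidualFun C m f₁ + multiplierToBidualFun C m f₂ := by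
  have := canonicalApproximateUnit_neBot C
  exact tendsto_nhds_unique (multiplierToBidualFun_tendsto C m (f₁ + f₂))
    ((multiplierToBidualFun_tendsto C m f₁).add (multiplierToBidualFun_tendsto C m f₂))

theorem multiplierToBidualFun_smul_right (m : 𝓜(ℂ, C)) (k : ℂ) (f : StrongDual ℂ B) :
    multiplierToBidualFun C m (k • f) = k • multiplierToBidualFun C m f := by
  have := canonicalApproximateUnit_neBot C
  exact tendsto_nhds_unique (multiplierToBidualFun_tendsto C m (k • f))
    ((multiplierToBidualFun_tendsto C m f).const_smul k)

theorem multiplierToBidualFun_add_left (m₁ m₂ : 𝓜(ℂ, C)) (f : StrongDual ℂ B) :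
    multiplierToBidualFun C (m₁ + m₂) f =
      multiplierToBidualFun C m₁ f + multiplierToBidualFun C m₂ f := by
  have := canonicalApproximateUnit_neBot C
  refine tendsto_nhds_unique (multiplierToBidualFun_tendsto C (m₁ + m₂) f)
    (((multiplierToBidualFun_tendsto C m₁ f).add (multiplierToBidualFun_tendsto C m₂ f)).congr
      fun e => ?_)
  simp

theorem multiplierToBidualFun_smul_left (k : ℂ) (m : 𝓜(ℂ, C)) (f : StrongDual ℂ B) :
    multiplierToBidualFun C (k • m) f = k • multiplierToBidualFun C m f := by
  have := canonicalApproximateUnit_neBot C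
  refine tendsto_nhds_unique (multiplierToBidualFun_tendsto C (k • m) f)
    (((multiplierToBidualFun_tendsto C m f).const_smul k).congr fun e => ?_)
  simp

theorem multiplierToBidualFun_norm_le (m : 𝓜(ℂ, C)) (f : StrongDual ℂ B) :
    ‖multiplierToBidualFun C m f‖ ≤ ‖m‖ * ‖f‖ := by
  have := canonicalApproximateUnit_neBot C
  refine le_of_tendsto (multiplierToBidualFun_tendsto C m f).norm ?_
  filter_upwards [canonicalApproximateUnit_eventually C] with e he
  refine ((multiplierFunctional C m f).le_opNorm e).trans ?_
  calc _ ≤ ‖multiplierFunctional C m f‖ * 1 := by gcongr; exact he.2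
    _ ≤ ‖m‖ * ‖f‖ := by
      rw [mul_one, mul_comm]
      exact LinearMap.mkContinuous_norm_le _ (by positivity) _

/-- The canonical embedding `M(C) ⊆ C** ⊆ B**` for a C⋆-subalgebra `C` of `B`: a multiplier `m` is
sent to the weak-`*` limit in `B**` of the net `m e` in `C ⊆ B`, where `e` runs through the
canonical approximate unit of `C`. -/
noncomputable def multiplierToBidual : 𝓜(ℂ, C) →ₗ[ℂ] Bidual B where
  toFun m := LinearMap.mkContinuous
    { toFun := multiplierToBidualFun C m
      map_add' := multiplierToBidualFun_add_right C m
      map_smul' := fun k f => multiplierToBidualFun_smul_right C m k f } ‖m‖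
    (multiplierToBidualFun_norm_le C m)
  map_add' m₁ m₂ := by
    ext f
    exact multiplierToBidualFun_add_left C m₁ m₂ f
  map_smul' k m := by
    ext f
    exact multiplierToBidualFun_smul_left C k m f

theorem multiplierToBidual_tendsto (m : 𝓜(ℂ, C)) (f : StrongDual ℂ B) :
    Tendsto (fun e : C => f (m.fst e : B)) (canonicalApproximateUnit C)
      (𝓝 (multiplierToBidual C m f)) :=
  multiplierToBidualFun_tendsto C m f

/-- On `C` itself the embedding `M(C) ⊆ B**` is the canonical embedding `C ⊆ B ⊆ B**`. -/
theorem multiplierToBidual_coe (c : C) :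
    multiplierToBidual C (DoubleCentralizer.coe ℂ c) =
      NormedSpace.inclusionInDoubleDual ℂ B (c : B) := by
  ext f
  have := canonicalApproximateUnit_neBot C
  refine tendsto_nhds_unique (multiplierToBidual_tendsto C (DoubleCentralizer.coe ℂ c) f) ?_
  exact ((f.continuous.comp continuous_subtype_val).tendsto c).comp
    (canonicalApproximateUnit_tendsto_left C c)

theorem multiplierToBidual_injective : Function.Injective (multiplierToBidual C) := by
  rw [injective_iff_map_eq_zero]
  intro m hm
  have := canonicalApproximateUnit_neBot C
  have key : ∀ c : C, m.fst c = 0 := by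
    intro c
    refine Subtype.ext ((SeparatingDual.eq_zero_iff_forall_dual_eq_zero (R := ℂ) (m.fst c : B)).2 ?_)
    intro f
    have h1 := multiplierToBidual_tendsto C m (f ∘L (ContinuousLinearMap.mul ℂ B).flip (c : B))
    rw [hm] at h1
    refine tendsto_nhds_unique ?_ h1
    have h2 : ∀ e : C, m.fst (e * c) = m.fst e * c := by
      intro e
      have hx : ∀ x : C, x * m.fst (e * c) = x * (m.fst e * c) := fun x => by
        rw [← m.central, ← mul_assoc, m.central, mul_assoc]
      exact tendsto_nhds_unique ((canonicalApproximateUnit_tendsto C (m.fst (e * c))).congr hx)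
        (canonicalApproximateUnit_tendsto C (m.fst e * c))
    have h3 := ((f.continuous.comp (continuous_subtype_val.comp m.fst.continuous)).tendsto c).comp
      (canonicalApproximateUnit_tendsto C c)
    refine h3.congr fun e => ?_
    simp [h2]
  have : ‖m‖ = 0 := by
    rw [← DoubleCentralizer.norm_fst m, norm_eq_zero]
    ext1 c
    exact key c
  exact norm_eq_zero.1 this

end

/-! Everything rests on the identity `φ (a * b) * φ c = φ a * φ (b * c)`
(`CompletelyPositiveMap.apply_mul_mul_apply`). Positivity of `φ` on 2 × 2 matrices gives a
Cauchy–Schwarz argument which extends the order zero condition from positive elements to all pairs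
with product zero. So the bilinear map `(x, y) ↦ φ (a x) φ (y c)` on the unitization of `A` kills
zero products. Bounded bilinear maps on a unital C⋆-algebra with this property satisfy `U b 1 = U 1
b`; functional calculus reduces that to real functions on the spectrum of a positive element, where
it follows by cutting `b` into thin layers.

Write `C` for `C*(φ(A))`. The vectors `φ (b) c` span a dense subspace of `C`, and so do the vectors
`φ (a b) c`. On them `π (a)` is prescribed by `φ (b) c ↦ φ (a b) c` and `h` by `φ (a b) c ↦ φ (a) φ
(b) c`. The identity makes both prescriptions adjointable. The first is bounded by `‖a‖`, as for a
representation on a Hilbert module (`exists_starAlgHom_multiplier`). The second is a limit of left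
multiplications by `φ (e)`, with `e` an approximate unit of `A`, hence bounded by `‖φ‖` and positive
(`exists_nonneg_multiplier`). The algebraic relations between `h`, `π` and the action are then
checked on spanning vectors.

The action on multipliers is conjugation by the restriction of `β` to `C`. It agrees with `β**`
because automorphisms preserve the canonical approximate unit along which multipliers are embedded
in the bidual (`multiplierToBidual_autHom`). -/

/-! ### Bilinear maps vanishing on zero products -/

section ZeroProduct

variable {K E : Type*} [TopologicalSpace K] [CompactSpace K] [NormedAddCommGroup E]
  [NormedSpace ℝ E]

/-- Averaging over signs: `V x₀ y₀ + V x y` is the mean of `V (x₀ + x) (y₀ + y)` and `V (x₀ - x) (y₀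
- y)`. The distinguished pair `x₀`, `y₀` absorbs the terms one at a time without violating the
pointwise bounds. The resulting bound does not depend on the number of terms. -/
theorem norm_add_sum_le_of_abs_sum_le_one {ι : Type*} [DecidableEq ι]
    (V : C(K, ℝ) →ₗ[ℝ] C(K, ℝ) →ₗ[ℝ] E) {M : ℝ} (hM : 0 ≤ M)
    (hV : ∀ f g, ‖V f g‖ ≤ M * ‖f‖ * ‖g‖) (x y : ι → C(K, ℝ)) (s : Finset ι) :
    ∀ x₀ y₀ : C(K, ℝ), (∀ t, |x₀ t| + ∑ k ∈ s, |x k t| ≤ 1) →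
      (∀ t, |y₀ t| + ∑ k ∈ s, |y k t| ≤ 1) → ‖V x₀ y₀ + ∑ k ∈ s, V (x k) (y k)‖ ≤ M := by
  induction s using Finset.induction_on with
  | empty =>
    intro x₀ y₀ hx hy
    have h1 : ‖x₀‖ ≤ 1 := (ContinuousMap.norm_le _ zero_le_one).2 fun t => by simpa using hx t
    have h2 : ‖y₀‖ ≤ 1 := (ContinuousMap.norm_le _ zero_le_one).2 fun t => by simpa using hy t
    calc _ ≤ M * ‖x₀‖ * ‖y₀‖ := by simpa using hV x₀ y₀
      _ ≤ M * 1 * 1 := by gcongr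
      _ = M := by ring
  | insert i s hi ih =>
    intro x₀ y₀ hx hy
    simp only [Finset.sum_insert hi] at hx hy ⊢
    have key : V x₀ y₀ + (V (x i) (y i) + ∑ k ∈ s, V (x k) (y k)) =
        (1 / 2 : ℝ) • ((V (x₀ + x i) (y₀ + y i) + ∑ k ∈ s, V (x k) (y k)) +
          (V (x₀ - x i) (y₀ - y i) + ∑ k ∈ s, V (x k) (y k))) := by
      simp only [map_add, map_sub, LinearMap.add_apply, LinearMap.sub_apply]
      module
    have h1 := ih (x₀ + x i) (y₀ + y i)
      (fun t => (hx t).trans' (by rw [← add_assoc]; gcongr; exact abs_add_le _ _))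
      (fun t => (hy t).trans' (by rw [← add_assoc]; gcongr; exact abs_add_le _ _))
    have h2 := ih (x₀ - x i) (y₀ - y i)
      (fun t => (hx t).trans' (by rw [← add_assoc]; gcongr; exact abs_sub _ _))
      (fun t => (hy t).trans' (by rw [← add_assoc]; gcongr; exact abs_sub _ _))
    rw [key, norm_smul]
    have := norm_add_le (V (x₀ + x i) (y₀ + y i) + ∑ k ∈ s, V (x k) (y k))
      (V (x₀ - x i) (y₀ - y i) + ∑ k ∈ s, V (x k) (y k))
    rw [Real.norm_of_nonneg (by norm_num : (0 : ℝ) ≤ 1 / 2)]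
    linarith

theorem sum_range_clamp {z : ℝ} (hz : 0 ≤ z) (m : ℕ) :
    ∑ k ∈ Finset.range m, max 0 (min 1 (z - k)) = min z m := by
  induction m with
  | zero => simp [hz]
  | succ m ih =>
    rw [Finset.sum_range_succ, ih]
    push_cast
    grind

/-- A bounded bilinear map on `C(K, ℝ)` that vanishes on pairs of functions with product zero is
balanced. -/
theorem apply_one_eq_one_apply_of_zero_product (V : C(K, ℝ) →ₗ[ℝ] C(K, ℝ) →ₗ[ℝ] E) {M : ℝ}
    (hV : ∀ f g, ‖V f g‖ ≤ M * ‖f‖ * ‖g‖) (hV₀ : ∀ f g, f * g = 0 → V f g = 0)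
    (b : C(K, ℝ)) (hb₀ : 0 ≤ b) (hb₁ : b ≤ 1) : V b 1 = V 1 b := by
  wlog hM : 0 ≤ M generalizing M
  · exact this (M := |M|) (fun f g => (hV f g).trans (by gcongr; exact le_abs_self M))
      (abs_nonneg M)
  have main : ∀ n : ℕ, n * ‖V b 1 - V 1 b‖ ≤ 2 * M := by
    intro n
    -- Layers of height one of `n b`: `H (k + 1)` is the part of `n b` between `k` and `k + 1`. The
    -- shift makes `H 0 = 1`, and `H k = 1` wherever a later `H j` is nonzero.
    let H : ℕ → C(K, ℝ) := fun k =>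
      ⟨fun t => max 0 (min 1 (n * b t - k + 1)), by fun_prop⟩
    have hz : ∀ t, 0 ≤ n * b t := fun t => mul_nonneg n.cast_nonneg (hb₀ t)
    have hH : ∀ k t, H k t = max 0 (min 1 (n * b t - k + 1)) := fun _ _ => rfl
    have hsum : ∑ k ∈ Finset.range n, H (k + 1) = (n : ℝ) • b := by
      ext t
      have h1 : n * b t ≤ n := mul_le_of_le_one_right n.cast_nonneg (hb₁ t)
      rw [ContinuousMap.sum_apply]
      simp only [hH, Nat.cast_add, Nat.cast_one, sub_add_eq_sub_sub, sub_add_cancel]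
      rw [sum_range_clamp (hz t), min_eq_left h1]
      rfl
    have hH0 : H 0 = 1 := by
      ext t
      have := hz t
      rw [hH, Nat.cast_zero, sub_zero, min_eq_left (by linarith), max_eq_right zero_le_one]
      rfl
    have hmul : ∀ k j, k < j → H j * (1 - H k) = 0 := by
      intro k j hkj
      ext t
      have : (k : ℝ) + 1 ≤ j := by exact_mod_cast hkj
      simp only [ContinuousMap.mul_apply, ContinuousMap.sub_apply, ContinuousMap.one_apply, hH,
        ContinuousMap.zero_apply, mul_eq_zero]
      grind
    have hmono : ∀ k t, 0 ≤ H k t - H (k + 1) t := by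
      intro k t
      simp only [hH, Nat.cast_add, Nat.cast_one]
      grind
    have hH01 : ∀ k t, 0 ≤ H k t ∧ H k t ≤ 1 := by
      intro k t
      simp only [hH]
      grind
    let x : ℕ → C(K, ℝ) := fun k => H (k + 1) - H (k + 2)
    let y : ℕ → C(K, ℝ) := fun k => H k - H (k + 1)
    -- The differences of consecutive layers are nonnegative and telescope, so their absolute values
    -- add up to at most one.
    have hxs : ∀ t, |(0 : C(K, ℝ)) t| + ∑ k ∈ Finset.range n, |x k t| ≤ 1 := by
      intro t
      have : ∑ k ∈ Finset.range n, |x k t| = H 1 t - H (n + 1) t := by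
        rw [← Finset.sum_range_sub' (fun k => H (k + 1) t) n]
        exact Finset.sum_congr rfl fun k _ => abs_of_nonneg (hmono (k + 1) t)
      rw [this]
      have := (hH01 1 t).2
      have := (hH01 (n + 1) t).1
      simp
      linarith
    have hys : ∀ t, |(0 : C(K, ℝ)) t| + ∑ k ∈ Finset.range n, |y k t| ≤ 1 := by
      intro t
      have : ∑ k ∈ Finset.range n, |y k t| = H 0 t - H n t := by
        rw [← Finset.sum_range_sub' (fun k => H k t) n]
        exact Finset.sum_congr rfl fun k _ => abs_of_nonneg (hmono k t)
      rw [this]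
      have := (hH01 0 t).2
      have := (hH01 n t).1
      simp
      linarith
    -- Since `H j * (1 - H k) = 0` for `k < j`, a `1` paired with `H j` may be replaced by `H k`. On
    -- expansion `V (x k) (y k)` becomes `V (H (k + 1)) 1 - V (H (k + 1)) (H (k + 1))`, and
    -- symmetrically for the other order; the diagonal terms cancel. Summing over `k` bounds `n ‖V b
    -- 1 - V 1 b‖` by `2 M` for every `n`.
    have hterm : ∀ k, V (H (k + 1)) 1 - V 1 (H (k + 1)) = V (x k) (y k) - V (y k) (x k) := by
      intro k
      have a1 := hV₀ _ _ (hmul k (k + 1) (by omega))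
      have a2 := hV₀ _ _ (hmul k (k + 2) (by omega))
      have a3 := hV₀ _ _ (hmul (k + 1) (k + 2) (by omega))
      have b1 := hV₀ _ _ ((mul_comm _ _).trans (hmul k (k + 1) (by omega)))
      have b2 := hV₀ _ _ ((mul_comm _ _).trans (hmul k (k + 2) (by omega)))
      have b3 := hV₀ _ _ ((mul_comm _ _).trans (hmul (k + 1) (k + 2) (by omega)))
      simp only [x, y, map_sub, LinearMap.sub_apply, sub_eq_zero] at *
      rw [a1, b1, a2.symm.trans a3, b2.symm.trans b3]
      abel
    have hxy := norm_add_sum_le_of_abs_sum_le_one V hM hV x y (Finset.range n) 0 0 hxs hys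
    have hyx := norm_add_sum_le_of_abs_sum_le_one V hM hV y x (Finset.range n) 0 0 hys hxs
    have hfin : (n : ℝ) • (V b 1 - V 1 b) =
        (V 0 0 + ∑ k ∈ Finset.range n, V (x k) (y k)) -
          (V 0 0 + ∑ k ∈ Finset.range n, V (y k) (x k)) := by
      rw [add_sub_add_left_eq_sub, ← Finset.sum_sub_distrib]
      simp only [← hterm]
      rw [Finset.sum_sub_distrib, ← map_sum, ← LinearMap.sum_apply, ← map_sum, hsum]
      simp [smul_sub]
    calc n * ‖V b 1 - V 1 b‖ = ‖(n : ℝ) • (V b 1 - V 1 b)‖ := by simp [norm_smul]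
      _ ≤ _ := by
        rw [hfin]
        refine (norm_sub_le _ _).trans ?_
        linarith
  by_contra hne
  have hpos : 0 < ‖V b 1 - V 1 b‖ := norm_pos_iff.2 (sub_ne_zero.2 hne)
  obtain ⟨n, hn⟩ := exists_nat_gt (2 * M / ‖V b 1 - V 1 b‖)
  rw [div_lt_iff₀ hpos] at hn
  linarith [main n]

end ZeroProduct

/-- A bounded bilinear map on a unital C⋆-algebra that vanishes on pairs of elements with product
zero is balanced. -/
theorem CStarAlgebra.apply_one_eq_one_apply_of_zero_product {D E : Type*} [CStarAlgebra D]
    [NormedAddCommGroup E] [NormedSpace ℂ E] (U : D →ₗ[ℂ] D →ₗ[ℂ] E) {M : ℝ}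
    (hU : ∀ x y, ‖U x y‖ ≤ M * ‖x‖ * ‖y‖) (hU₀ : ∀ x y, x * y = 0 → U x y = 0) (b : D) :
    U b 1 = U 1 b := by
  let _ : PartialOrder D := CStarAlgebra.spectralOrder D
  let _ : StarOrderedRing D := CStarAlgebra.spectralOrderedRing D
  -- Both sides are linear in `b`, and the positive elements of the open unit ball span `D`.
  suffices h : ∀ b : D, b ∈ ({x | 0 ≤ x} ∩ Metric.ball 0 1 : Set D) → U b 1 = U 1 b by
    have hb : b ∈ Submodule.span ℂ ({x | 0 ≤ x} ∩ Metric.ball 0 1 : Set D) := by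
      simp [CStarAlgebra.span_nonneg_inter_unitBall]
    induction hb using Submodule.span_induction with
    | mem x hx => exact h x hx
    | zero => simp
    | add x y _ _ hx hy => simp [hx, hy]
    | smul c x _ hx => simp [hx]
  rintro b ⟨hb₀ : 0 ≤ b, hb₁⟩
  rcases subsingleton_or_nontrivial D with _ | _
  · rw [Subsingleton.elim b 1]
  have hsa : IsSelfAdjoint b := .of_nonneg hb₀
  -- The functional calculus is isometric and multiplicative, so `U` pulls back to a bounded real
  -- bilinear map on functions which still vanishes on zero products.
  let Θ : C(spectrum ℝ b, ℝ) →⋆ₐ[ℝ] D := cfcHom hsa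
  have hΘ : ∀ f, ‖Θ f‖ = ‖f‖ := norm_cfcHom (𝕜 := ℝ) b
  let V : C(spectrum ℝ b, ℝ) →ₗ[ℝ] C(spectrum ℝ b, ℝ) →ₗ[ℝ] E :=
    LinearMap.mk₂ ℝ (fun f g => U (Θ f) (Θ g)) (by simp)
      (fun c f g => by
        rw [map_smul, ← Complex.coe_smul, map_smul, LinearMap.smul_apply, Complex.coe_smul])
      (by simp)
      (fun c f g => by rw [map_smul, ← Complex.coe_smul, map_smul, Complex.coe_smul])
  have := _root_.apply_one_eq_one_apply_of_zero_product V (M := M)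
    (fun f g => by rw [← hΘ f, ← hΘ g]; exact hU (Θ f) (Θ g))
    (fun f g h => hU₀ _ _ (by rw [← map_mul, h, map_zero]))
    ((ContinuousMap.id ℝ).restrict (spectrum ℝ b))
    (fun t => spectrum_nonneg_of_nonneg hb₀ t.2)
    (fun t => by
      have h1 := spectrum.norm_le_norm_of_mem t.2
      have h2 : ‖b‖ < 1 := by simpa using hb₁
      exact (le_abs_self _).trans (h1.trans h2.le))
  have hid : Θ ((ContinuousMap.id ℝ).restrict (spectrum ℝ b)) = b := cfcHom_id hsa
  simpa [V, hid] using this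

/-! ### Order zero completely positive maps -/

namespace CompletelyPositiveMap

variable {A B : Type*} [NonUnitalCStarAlgebra A] [PartialOrder A] [StarOrderedRing A]
  [NonUnitalCStarAlgebra B] [PartialOrder B] [StarOrderedRing B] (φ : A →CP B)

theorem apply_nonneg {a : A} (ha : 0 ≤ a) : 0 ≤ φ a := by
  simpa using (OrderHomClass.mono φ ha : φ 0 ≤ φ a)

theorem apply_star (a : A) : φ (star a) = star (φ a) := by
  have ha : a ∈ Submodule.span ℂ {a : A | 0 ≤ a} := by simp [CStarAlgebra.span_nonneg]
  induction ha using Submodule.span_induction with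
  | mem x hx =>
    rw [(IsSelfAdjoint.of_nonneg hx).star_eq,
      (IsSelfAdjoint.of_nonneg (φ.apply_nonneg hx)).star_eq]
  | zero => simp
  | add x y _ _ hx hy => simp [hx, hy]
  | smul c x _ hx => simp [hx]

/-- A positive matrix is a sum of matrices `star X * X`, and the quadratic form of each of these at
the column `(y, z)` is the sum of the squares `star r * r` over the entries `r` of `X (y, z)`. -/
theorem _root_.CStarMatrix.quadratic_nonneg {M : CStarMatrix (Fin 2) (Fin 2) B} (hM : 0 ≤ M)
    (y z : B) : 0 ≤ star y * M 0 0 * y + star y * M 0 1 * z +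
      (star z * M 1 0 * y + star z * M 1 1 * z) := by
  rw [StarOrderedRing.nonneg_iff] at hM
  induction hM using AddSubmonoid.closure_induction with
  | mem _ hx =>
    obtain ⟨X, rfl⟩ := hx
    simp only [CStarMatrix.mul_apply, Fin.sum_univ_two, CStarMatrix.star_apply]
    have : star y * (star (X 0 0) * X 0 0 + star (X 1 0) * X 1 0) * y +
        star y * (star (X 0 0) * X 0 1 + star (X 1 0) * X 1 1) * z +
        (star z * (star (X 0 1) * X 0 0 + star (X 1 1) * X 1 0) * y +
        star z * (star (X 0 1) * X 0 1 + star (X 1 1) * X 1 1) * z) =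
        star (X 0 0 * y + X 0 1 * z) * (X 0 0 * y + X 0 1 * z) +
        star (X 1 0 * y + X 1 1 * z) * (X 1 0 * y + X 1 1 * z) := by
      simp only [star_add, star_mul]
      noncomm_ring
    rw [this]
    exact add_nonneg (star_mul_self_nonneg _) (star_mul_self_nonneg _)
  | zero => simp
  | add M N _ _ hM hN =>
    refine (add_nonneg hM hN).trans_eq ?_
    simp only [CStarMatrix.add_apply]
    noncomm_ring

theorem quadratic_nonneg (a c : A) (y z : B) :
    0 ≤ star y * φ (star a * a) * y + star y * φ (star a * c) * z +
      (star z * φ (star c * a) * y + star z * φ (star c * c) * z) := by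
  let R : CStarMatrix (Fin 2) (Fin 2) A := CStarMatrix.ofMatrix !![a, c; 0, 0]
  have hR : 0 ≤ (star R * R).map φ := φ.map_cstarMatrix_nonneg _ (star_mul_self_nonneg R)
  simpa [CStarMatrix.mul_apply, CStarMatrix.star_apply, R] using
    CStarMatrix.quadratic_nonneg hR y z

/-- Cauchy–Schwarz for 2-positive maps in degenerate form: if a diagonal term of a nonnegative
quadratic form vanishes, so does the mixed term. This gives `φ (star e * a) * z = 0` for every `e`,
and an approximate unit then removes `e`. -/
theorem apply_mul_eq_zero_of_conjugate_eq_zero (a : A) (z : B)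
    (hz : star z * φ (star a * a) * z = 0) : φ a * z = 0 := by
  have step : ∀ e : A, φ (star e * a) * z = 0 := by
    intro e
    set w := φ (star e * a) * z with hw
    have hw' : star z * φ (star a * e) = star w := by
      rw [hw, star_mul, ← apply_star]
      simp
    have key : ∀ t : ℝ, 0 < t → 2 * ‖w‖ ^ 2 ≤ t * ‖star w * φ (star e * e) * w‖ := by
      intro t ht
      -- At `(-t w, z)` the form is `t² w* φ(e* e) w - 2 t w* w`, the last diagonal term being zero.
      -- Dividing by `t` and letting `t → 0` forces `w = 0`.
      have h := φ.quadratic_nonneg e a ((-t : ℂ) • w) z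
      rw [hz, add_zero, hw', mul_assoc _ (φ (star e * a)) z, ← hw] at h
      simp only [star_smul, smul_mul_assoc, mul_smul_comm, star_neg, Complex.star_def,
        Complex.conj_ofReal] at h
      have h2 : (2 * t : ℝ) • (star w * w) ≤ (t ^ 2 : ℝ) • (star w * φ (star e * e) * w) := by
        rw [← sub_nonneg]
        convert h using 1
        simp only [← Complex.coe_smul]
        push_cast
        module
      have h3 := CStarAlgebra.norm_le_norm_of_nonneg_of_le
        (smul_nonneg (by positivity) (star_mul_self_nonneg w)) h2
      rw [norm_smul, norm_smul, CStarRing.norm_star_mul_self, Real.norm_of_nonneg (by positivity),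
        Real.norm_of_nonneg (by positivity)] at h3
      have : t * (2 * ‖w‖ ^ 2) ≤ t * (t * ‖star w * φ (star e * e) * w‖) := by nlinarith
      exact le_of_mul_le_mul_left this ht
    have hlim : Tendsto (fun t : ℝ => t * ‖star w * φ (star e * e) * w‖) (𝓝[>] 0) (𝓝 0) := by
      have : Tendsto (fun t : ℝ => t * ‖star w * φ (star e * e) * w‖) (𝓝 0)
          (𝓝 (0 * ‖star w * φ (star e * e) * w‖)) := tendsto_id.mul_const _
      rw [zero_mul] at this
      exact this.mono_left nhdsWithin_le_nhds
    have h0 := ge_of_tendsto hlim (eventually_nhdsWithin_of_forall key)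
    exact norm_eq_zero.1 (pow_eq_zero_iff two_ne_zero |>.1
      (le_antisymm (by linarith) (sq_nonneg ‖w‖)))
  have := canonicalApproximateUnit_neBot A
  have hφ : Continuous φ := map_continuous φ
  refine tendsto_nhds_unique (((hφ.tendsto _).comp
    (canonicalApproximateUnit_tendsto A a)).mul_const z) ?_
  refine tendsto_const_nhds.congr' ?_
  filter_upwards [canonicalApproximateUnit_eventually A] with e he
  simpa [he.1] using (step e).symm

variable {φ}

/-- An order zero completely positive map preserves zero products of arbitrary elements. -/
theorem apply_mul_apply_eq_zero
    (hφ₀ : ∀ a b : A, 0 ≤ a → 0 ≤ b → a * b = 0 → φ a * φ b = 0) {a b : A} (hab : a * b = 0) :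
    φ a * φ b = 0 := by
  -- The hypothesis applies to the positive elements `a* a` and `b b*`, whose product is zero. Two
  -- uses of the degenerate Cauchy–Schwarz argument, the second after taking adjoints, strip `a*`
  -- and then `b*`.
  have h1 : φ (star a * a) * φ (b * star b) = 0 :=
    hφ₀ _ _ (star_mul_self_nonneg a) (mul_star_self_nonneg b)
      (by rw [mul_assoc, ← mul_assoc a, hab, zero_mul, mul_zero])
  have h2 : φ a * φ (b * star b) = 0 := by
    refine φ.apply_mul_eq_zero_of_conjugate_eq_zero a _ ?_
    rw [mul_assoc, h1, mul_zero]
  have h3 : φ (star b) * star (φ a) = 0 := by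
    refine φ.apply_mul_eq_zero_of_conjugate_eq_zero (star b) _ ?_
    rw [star_star, star_star, h2, zero_mul]
  rw [φ.apply_star, ← star_mul, star_eq_zero] at h3
  exact h3

/-- The structural identity of order zero maps: `φ (a b) φ (c) = φ (a) φ (b c)`. -/
theorem apply_mul_mul_apply
    (hφ₀ : ∀ a b : A, 0 ≤ a → 0 ≤ b → a * b = 0 → φ a * φ b = 0) (a b c : A) :
    φ (a * b) * φ c = φ a * φ (b * c) := by
  obtain ⟨K, hK⟩ : ∃ K : ℝ, ∀ a, ‖φ a‖ ≤ K * ‖a‖ := by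
    obtain ⟨K, hK⟩ := PositiveLinearMap.exists_norm_apply_le (.ofClass φ : A →ₚ[ℂ] B)
    exact ⟨K, hK⟩
  let L : Unitization ℂ A → A := fun x => x.fst • a + a * x.snd
  let R : Unitization ℂ A → A := fun x => x.fst • c + x.snd * c
  have hL : ∀ x, (L x : Unitization ℂ A) = a * x := by
    intro x
    ext <;> simp [L]
  have hR : ∀ x, (R x : Unitization ℂ A) = x * c := by
    intro x
    ext <;> simp [R]
  -- `U x y = φ (a x) φ (y c)`. The unitization supplies the `1` needed for the balancing theorem,
  -- while `a x` and `y c` remain in `A`. If `x y = 0` then `(a x) (y c) = 0`, and `U b 1 = U 1 b`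
  -- is the claim.
  let U : Unitization ℂ A →ₗ[ℂ] Unitization ℂ A →ₗ[ℂ] B :=
    LinearMap.mk₂ ℂ (fun x y => φ (L x) * φ (R y))
      (fun x x' y => by
        rw [← add_mul, ← map_add]
        congr 2
        simp only [L, Unitization.fst_add, Unitization.snd_add, mul_add, add_smul]
        abel)
      (fun k x y => by
        rw [← smul_mul_assoc, ← map_smul]
        congr 2
        simp [L, mul_smul, mul_smul_comm])
      (fun x y y' => by
        rw [← mul_add, ← map_add]
        congr 2
        simp only [R, Unitization.fst_add, Unitization.snd_add, add_mul, add_smul]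
        abel)
      (fun k x y => by
        rw [← mul_smul_comm, ← map_smul]
        congr 2
        simp [R, mul_smul, smul_mul_assoc])
  have hLn : ∀ x, ‖φ (L x)‖ ≤ |K| * (‖a‖ * ‖x‖) := by
    intro x
    refine (hK _).trans ?_
    gcongr
    · exact le_abs_self K
    · rw [← Unitization.norm_inr (𝕜 := ℂ), hL, ← Unitization.norm_inr (𝕜 := ℂ) a]
      exact norm_mul_le _ _
  have hRn : ∀ x, ‖φ (R x)‖ ≤ |K| * (‖x‖ * ‖c‖) := by
    intro x
    refine (hK _).trans ?_
    gcongr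
    · exact le_abs_self K
    · rw [← Unitization.norm_inr (𝕜 := ℂ), hR, ← Unitization.norm_inr (𝕜 := ℂ) c]
      exact norm_mul_le _ _
  have := CStarAlgebra.apply_one_eq_one_apply_of_zero_product U
    (M := |K| * ‖a‖ * (|K| * ‖c‖))
    (fun x y => by
      refine (norm_mul_le _ _).trans ((mul_le_mul (hLn x) (hRn y) (norm_nonneg _)
        (by positivity)).trans_eq (by ring)))
    (fun x y hxy => by
      refine apply_mul_apply_eq_zero hφ₀ (Unitization.inr_injective (R := ℂ) ?_)
      rw [Unitization.inr_mul, hL, hR, mul_assoc, ← mul_assoc x, hxy]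
      simp)
    (b : Unitization ℂ A)
  simpa [U, L, R] using this

end CompletelyPositiveMap

/-! ### Positivity expressed by norms -/

theorem CStarAlgebra.nonneg_of_norm_algebraMap_sub_le {D : Type*} [CStarAlgebra D] [PartialOrder D]
    [StarOrderedRing D] {a : D} (ha : IsSelfAdjoint a) {t : ℝ} (hat : ‖a‖ ≤ t)
    (h : ‖algebraMap ℝ D t - a‖ ≤ t) : 0 ≤ a := by
  lift t to NNReal using (norm_nonneg a).trans hat
  exact nonneg_iff_isSelfAdjoint_and_quasispectrumRestricts.2
    ⟨ha, (SpectrumRestricts.nnreal_iff_nnnorm ha hat).2 h⟩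

/-- In the unitization `0 ≤ t - b ≤ t`. Stated through left multiplication, the estimate passes to
the pointwise limits of `φ (e)` that define `h`, where the preceding criterion turns it back into
positivity. -/
theorem norm_smul_sub_mul_le_of_nonneg {B : Type*} [NonUnitalCStarAlgebra B] [PartialOrder B]
    [StarOrderedRing B] {b : B} (hb : 0 ≤ b) {t : ℝ} (hbt : ‖b‖ ≤ t) (x : B) :
    ‖(t : ℂ) • x - b * x‖ ≤ t * ‖x‖ := by
  have ht : 0 ≤ t := (norm_nonneg b).trans hbt
  have hb' : 0 ≤ (b : Unitization ℂ B) := Unitization.inr_nonneg_iff.2 hb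
  have h1 : (b : Unitization ℂ B) ≤ algebraMap ℝ _ t :=
    (IsSelfAdjoint.le_algebraMap_norm_self (.of_nonneg hb')).trans
      (algebraMap_mono _ (by rwa [Unitization.norm_inr]))
  have h2 : ‖algebraMap ℝ (Unitization ℂ B) t - b‖ ≤ t := by
    refine (CStarAlgebra.norm_le_norm_of_nonneg_of_le (sub_nonneg.2 h1)
      (sub_le_self _ hb')).trans ?_
    rw [norm_algebraMap', Real.norm_of_nonneg ht]
  have h3 : (((t : ℂ) • x - b * x : B) : Unitization ℂ B) =
      (algebraMap ℝ (Unitization ℂ B) t - b) * x := by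
    rw [sub_mul, ← Algebra.smul_def, Unitization.inr_sub, Unitization.inr_mul,
      Unitization.inr_smul, Complex.coe_smul]
  rw [← Unitization.norm_inr (𝕜 := ℂ), h3, ← Unitization.norm_inr (𝕜 := ℂ) x]
  exact (norm_mul_le _ _).trans (by gcongr)

/-! ### Multipliers prescribed on a dense span -/

namespace DoubleCentralizer

variable {C : Type*} [NonUnitalCStarAlgebra C]

theorem ext_of_fst {m₁ m₂ : 𝓜(ℂ, C)} (h : m₁.fst = m₂.fst) : m₁ = m₂ := by
  rw [← sub_eq_zero, ← norm_eq_zero, ← norm_fst, sub_fst, h, sub_self, norm_zero]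

theorem ext_of_dense_span {ι : Type*} {u : ι → C}
    (hu : Dense (Submodule.span ℂ (Set.range u) : Set C)) {m₁ m₂ : 𝓜(ℂ, C)}
    (h : ∀ i, m₁.fst (u i) = m₂.fst (u i)) : m₁ = m₂ :=
  ext_of_fst (ContinuousLinearMap.ext_on hu (by rintro _ ⟨i, rfl⟩; exact h i))

/-- A multiplier is determined by compatible bounded prescriptions of left multiplication by it and
by its adjoint on a family with dense span. -/
theorem exists_of_dense_span {ι : Type*} {u v v' : ι → C}
    (hu : Dense (Submodule.span ℂ (Set.range u) : Set C)) {K : ℝ} (hK : 0 ≤ K)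
    (hv : ∀ p : ι →₀ ℂ, ‖Finsupp.linearCombination ℂ v p‖ ≤
      K * ‖Finsupp.linearCombination ℂ u p‖)
    (hv' : ∀ p : ι →₀ ℂ, ‖Finsupp.linearCombination ℂ v' p‖ ≤
      K * ‖Finsupp.linearCombination ℂ u p‖)
    (hc : ∀ i j, star (v' i) * u j = star (u i) * v j) :
    ∃ m : 𝓜(ℂ, C), ‖m‖ ≤ K ∧ (∀ i, m.fst (u i) = v i) ∧ ∀ i, (star m).fst (u i) = v' i := by
  have hd : DenseRange (Finsupp.linearCombination ℂ u) := by
    rw [← Finsupp.range_linearCombination] at hu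
    rwa [DenseRange, ← LinearMap.coe_range]
  -- The bounds make both prescriptions well defined on the span and extend them by continuity. The
  -- compatibility `hc` then says that `T'` is the adjoint of `T` for the pairing `star x * y`.
  let T := (Finsupp.linearCombination ℂ v).extendOfNorm (Finsupp.linearCombination ℂ u)
  let T' := (Finsupp.linearCombination ℂ v').extendOfNorm (Finsupp.linearCombination ℂ u)
  have hT : ∀ i, T (u i) = v i := fun i => by
    simpa using LinearMap.extendOfNorm_eq hd ⟨K, hv⟩ (Finsupp.single i 1)
  have hT' : ∀ i, T' (u i) = v' i := fun i => by
    simpa using LinearMap.extendOfNorm_eq hd ⟨K, hv'⟩ (Finsupp.single i 1)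
  have hcen : ∀ x y, star (T' x) * y = star x * T y := by
    have h1 : ∀ i y, star (v' i) * y = star (u i) * T y := fun i y => by
      have := ContinuousLinearMap.ext_on (f := ContinuousLinearMap.mul ℂ C (star (v' i)))
        (g := ContinuousLinearMap.mul ℂ C (star (u i)) ∘L T) hu
        (by rintro _ ⟨j, rfl⟩; simp [hT, hc])
      exact congrArg (fun S : C →L[ℂ] C => S y) this
    intro x y
    have := ContinuousLinearMap.ext_on (f := ContinuousLinearMap.mul ℂ C (star y) ∘L T')
      (g := ContinuousLinearMap.mul ℂ C (star (T y))) hu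
      (by
        rintro _ ⟨i, rfl⟩
        simpa [hT'] using congrArg star (h1 i y))
    simpa using congrArg (fun S : C →L[ℂ] C => star (S x)) this
  -- Right multiplication by the multiplier is `x ↦ star (T' (star x))`; centrality is the adjoint
  -- relation `hcen`.
  let m : 𝓜(ℂ, C) :=
    { fst := T
      snd := (((starₗᵢ ℂ : C ≃ₗᵢ⋆[ℂ] C) : C →L⋆[ℂ] C).comp T').comp
          ((starₗᵢ ℂ : C ≃ₗᵢ⋆[ℂ] C) : C →L⋆[ℂ] C)
      central := fun x y => by
        have := hcen (star x) y
        rw [star_star] at this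
        exact this }
  refine ⟨m, ?_, hT, fun i => ?_⟩
  · rw [← norm_fst]
    exact LinearMap.opNorm_extendOfNorm_le hd hK hv
  · rw [star_fst]
    change star (star (T' (star (star (u i))))) = v' i
    rw [star_star, star_star, hT']

end DoubleCentralizer

/-! ### The automorphism of the multiplier algebra induced by an automorphism -/

namespace DoubleCentralizer

variable {C : Type*} [NonUnitalCStarAlgebra C]

/-- The action of an automorphism `σ` of `C` on `M(C)`: conjugation of the pair of left and right
multiplication maps by `σ`. -/
noncomputable def mapAut (σ : C ≃⋆ₐ[ℂ] C) (m : 𝓜(ℂ, C)) : 𝓜(ℂ, C) where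
  fst := autToCLM σ ∘L m.fst ∘L autToCLM σ⁻¹
  snd := autToCLM σ ∘L m.snd ∘L autToCLM σ⁻¹
  central x y := by
    change σ (m.snd (σ.symm x)) * y = x * σ (m.fst (σ.symm y))
    have := congrArg σ (m.central (σ.symm x) (σ.symm y))
    rwa [map_mul, map_mul, σ.apply_symm_apply, σ.apply_symm_apply] at this

theorem mapAut_mapAut (σ τ : C ≃⋆ₐ[ℂ] C) (m : 𝓜(ℂ, C)) :
    mapAut σ (mapAut τ m) = mapAut (σ * τ) m :=
  rfl

theorem mapAut_one (m : 𝓜(ℂ, C)) : mapAut 1 m = m :=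
  rfl

/-- The homomorphism `Aut(C) → Aut(M(C))`. -/
noncomputable def autHom : (C ≃⋆ₐ[ℂ] C) →* (𝓜(ℂ, C) ≃⋆ₐ[ℂ] 𝓜(ℂ, C)) where
  toFun σ :=
    { toFun := mapAut σ
      invFun := mapAut σ⁻¹
      left_inv := fun m => by rw [mapAut_mapAut, inv_mul_cancel, mapAut_one]
      right_inv := fun m => by rw [mapAut_mapAut, mul_inv_cancel, mapAut_one]
      map_mul' := fun m n => by
        refine ext_of_fst (ContinuousLinearMap.ext fun x => ?_)
        change σ (m.fst (n.fst (σ.symm x))) = σ (m.fst (σ.symm (σ (n.fst (σ.symm x)))))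
        rw [σ.symm_apply_apply]
      map_add' := fun m n => by
        refine ext_of_fst (ContinuousLinearMap.ext fun x => ?_)
        exact map_add σ _ _
      map_star' := fun m => by
        refine ext_of_fst (ContinuousLinearMap.ext fun x => ?_)
        change σ (star (m.snd (star (σ.symm x)))) = star (σ (m.snd (σ.symm (star x))))
        rw [← map_star σ.symm, map_star σ]
      map_smul' := fun k m => by
        refine ext_of_fst (ContinuousLinearMap.ext fun x => ?_)
        exact map_smul σ k _ }
  map_one' := rfl
  map_mul' _ _ := rfl

end DoubleCentralizer

/-- The filter is defined by the order and the norm alone, and `σ` and its inverse are monotone and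
contractive. -/
theorem tendsto_canonicalApproximateUnit_aut {C : Type*} [NonUnitalCStarAlgebra C]
    (σ : C ≃⋆ₐ[ℂ] C) :
    Tendsto σ (canonicalApproximateUnit C) (canonicalApproximateUnit C) := by
  let _ : PartialOrder C := CStarAlgebra.spectralOrder C
  let _ : StarOrderedRing C := CStarAlgebra.spectralOrderedRing C
  have hmono : ∀ (τ : C ≃⋆ₐ[ℂ] C) {x y : C}, x ≤ y → τ x ≤ τ y := fun τ x y h =>
    OrderHomClass.mono τ h
  have hnorm : ∀ (τ : C ≃⋆ₐ[ℂ] C) (x : C), ‖τ x‖ ≤ ‖x‖ := fun τ x =>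
    NonUnitalStarAlgHom.norm_apply_le (F := C ≃⋆ₐ[ℂ] C) τ x
  have hb := CStarAlgebra.hasBasis_approximateUnit C
  refine (hb.tendsto_iff hb).2 fun x ⟨hx0, hx1⟩ => ⟨σ.symm x, ⟨?_, ?_⟩, ?_⟩
  · simpa using hmono σ.symm hx0
  · exact (hnorm σ.symm x).trans_lt hx1
  · rintro y ⟨hy1, hy2⟩
    refine ⟨?_, ?_⟩
    · simpa using hmono σ hy1
    · simp only [Metric.mem_closedBall, dist_zero_right] at hy2 ⊢
      exact (hnorm σ y).trans hy2

/-! ### Restriction of the action and the bidual map -/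

section Restrict

variable {B : Type*} [NonUnitalCStarAlgebra B]

theorem aut_mem_cstarGenerated {S : Set B} {σ : B ≃⋆ₐ[ℂ] B} (hσ : ∀ s ∈ S, σ s ∈ S) {b : B}
    (hb : b ∈ cstarGenerated S) : σ b ∈ cstarGenerated S := by
  have hcont : Continuous σ := (autToCLM σ).continuous
  let D : NonUnitalStarSubalgebra ℂ B := (cstarGenerated S).comap (σ : B →⋆ₙₐ[ℂ] B)
  have hD : IsClosed (D : Set B) := (cstarGenerated_isClosed S).preimage hcont
  exact NonUnitalStarSubalgebra.topologicalClosure_minimal (t := D) _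
    (NonUnitalStarAlgebra.adjoin_le fun s hs => subset_cstarGenerated S (hσ s hs)) hD hb

/-- The restriction of a group of automorphisms preserving `S` to `C*(S)`. -/
noncomputable def restrictAut {G : Type*} [Group G] (β : G →* (B ≃⋆ₐ[ℂ] B)) (S : Set B)
    (hβ : ∀ g, ∀ s ∈ S, β g s ∈ S) : G →* (cstarGenerated S ≃⋆ₐ[ℂ] cstarGenerated S) where
  toFun g :=
    { toFun := fun c => ⟨β g c, aut_mem_cstarGenerated (hβ g) c.2⟩
      invFun := fun c => ⟨β g⁻¹ c, aut_mem_cstarGenerated (hβ g⁻¹) c.2⟩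
      left_inv := fun c => Subtype.ext (by simp [← StarAlgEquiv.mul_apply])
      right_inv := fun c => Subtype.ext (by simp [← StarAlgEquiv.mul_apply])
      map_mul' := fun x y => Subtype.ext (map_mul (β g) _ _)
      map_add' := fun x y => Subtype.ext (map_add (β g) _ _)
      map_star' := fun x => Subtype.ext (map_star (β g) _)
      map_smul' := fun k x => Subtype.ext (map_smul (β g) k _) }
  map_one' := by
    ext c
    change β 1 (c : B) = c
    rw [map_one, StarAlgEquiv.one_apply]
  map_mul' g g' := by
    ext c
    change β (g * g') (c : B) = β g (β g' c)
    rw [map_mul, StarAlgEquiv.mul_apply]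

/-- The transported multiplier sends `e` to `β g (m (σ⁻¹ e))`, with `σ` the restriction of `β g`. As
`σ⁻¹` preserves the approximate unit, the limit is the same as that of `β g (m e)`. -/
theorem multiplierToBidual_autHom {G : Type*} [Group G] (β : G →* (B ≃⋆ₐ[ℂ] B)) (S : Set B)
    (hβ : ∀ g, ∀ s ∈ S, β g s ∈ S) (g : G) (m : 𝓜(ℂ, cstarGenerated S)) :
    multiplierToBidual (cstarGenerated S) (DoubleCentralizer.autHom (restrictAut β S hβ g) m) =
      bidualMap (autToCLM (β g)) (multiplierToBidual (cstarGenerated S) m) := by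
  have := canonicalApproximateUnit_neBot (cstarGenerated S)
  ext f
  refine tendsto_nhds_unique (multiplierToBidual_tendsto _ _ f) ?_
  exact (multiplierToBidual_tendsto _ m (f ∘L autToCLM (β g))).comp
    (tendsto_canonicalApproximateUnit_aut (restrictAut β S hβ g)⁻¹)

end Restrict

/-! ### Construction of the representation and of the positive multiplier -/

section Construction

variable {A C : Type*} [NonUnitalCStarAlgebra A] [NonUnitalCStarAlgebra C] {ψ : A →L[ℂ] C}

/-- The closed span is a right ideal, and it contains each `ψ a` by an approximate unit of `C`;
hence it contains the ⋆-algebra generated by the image. -/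
theorem dense_span_apply_mul (hstar : ∀ a, ψ (star a) = star (ψ a))
    (hgen : Dense (NonUnitalStarAlgebra.adjoin ℂ (Set.range ψ) : Set C)) :
    Dense (Submodule.span ℂ (Set.range fun p : A × C => ψ p.1 * p.2) : Set C) := by
  set W := (Submodule.span ℂ (Set.range fun p : A × C => ψ p.1 * p.2)).topologicalClosure with hW
  have hWc : IsClosed (W : Set C) := Submodule.isClosed_topologicalClosure _
  have hψ : ∀ a, ψ a ∈ W := fun a => by
    have := canonicalApproximateUnit_neBot C
    refine hWc.mem_of_tendsto (canonicalApproximateUnit_tendsto_left C (ψ a))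
      (.of_forall fun e => Submodule.le_topologicalClosure _ (Submodule.subset_span ⟨(a, e), rfl⟩))
  have hmul : ∀ x ∈ W, ∀ y, x * y ∈ W := fun x hx y => by
    refine map_mem_closure (f := (· * y)) (continuous_mul_const y) hx fun z hz => ?_
    change z * y ∈ Submodule.span ℂ _
    induction hz using Submodule.span_induction with
    | mem z hz =>
      obtain ⟨p, rfl⟩ := hz
      exact Submodule.subset_span ⟨(p.1, p.2 * y), (mul_assoc _ _ _).symm⟩
    | zero => simp
    | add z z' _ _ h h' => rw [add_mul]; exact add_mem h h'
    | smul k z _ h => rw [smul_mul_assoc]; exact Submodule.smul_mem _ k h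
  -- A right ideal need not be closed under `star`, so membership of `star x` is carried through the
  -- induction.
  have hadj : ∀ x ∈ NonUnitalStarAlgebra.adjoin ℂ (Set.range ψ), x ∈ W ∧ star x ∈ W := by
    intro x hx
    induction hx using NonUnitalStarAlgebra.adjoin_induction with
    | mem x hx =>
      obtain ⟨a, rfl⟩ := hx
      exact ⟨hψ a, hstar a ▸ hψ (star a)⟩
    | add x y _ _ hx hy => rw [star_add]; exact ⟨add_mem hx.1 hy.1, add_mem hx.2 hy.2⟩
    | zero => simp
    | mul x y _ _ hx hy => rw [star_mul]; exact ⟨hmul _ hx.1 _, hmul _ hy.2 _⟩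
    | smul k x _ hx =>
      rw [star_smul]
      exact ⟨Submodule.smul_mem _ _ hx.1, Submodule.smul_mem _ _ hx.2⟩
    | star x _ hx => rw [star_star]; exact hx.symm
  intro x
  exact closure_minimal (fun y hy => (hadj y hy).1) hWc (hgen x)

theorem dense_span_apply_mul_mul
    (hd : Dense (Submodule.span ℂ (Set.range fun p : A × C => ψ p.1 * p.2) : Set C)) :
    Dense (Submodule.span ℂ (Set.range fun p : A × A × C => ψ (p.1 * p.2.1) * p.2.2) : Set C) := by
  set W := (Submodule.span ℂ
    (Set.range fun p : A × A × C => ψ (p.1 * p.2.1) * p.2.2)).topologicalClosure with hW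
  have hWc : IsClosed (W : Set C) := Submodule.isClosed_topologicalClosure _
  have hle : Submodule.span ℂ (Set.range fun p : A × C => ψ p.1 * p.2) ≤ W := by
    rw [Submodule.span_le]
    rintro _ ⟨⟨a, c⟩, rfl⟩
    have := canonicalApproximateUnit_neBot A
    exact hWc.mem_of_tendsto
      (((ψ.continuous.tendsto _).comp (canonicalApproximateUnit_tendsto A a)).mul_const c)
      (.of_forall fun e => Submodule.le_topologicalClosure _
        (Submodule.subset_span ⟨(e, a, c), rfl⟩))
  intro x
  exact closure_minimal hle hWc (hd x)

/-- The non-degenerate representation `π` of `A` by multipliers of `C` determined by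
`π (a) ψ (b) c = ψ (a b) c`. -/
theorem exists_starAlgHom_multiplier (hstar : ∀ a, ψ (star a) = star (ψ a))
    (hkey : ∀ a b c, ψ (a * b) * ψ c = ψ a * ψ (b * c))
    (hd : Dense (Submodule.span ℂ (Set.range fun p : A × C => ψ p.1 * p.2) : Set C)) :
    ∃ π : A →⋆ₙₐ[ℂ] 𝓜(ℂ, C), ∀ a b c, (π a).fst (ψ b * c) = ψ (a * b) * c := by
  -- With `T x = ∑ pᵢ ψ(x bᵢ) cᵢ` for `x` in the unitization, `hkey` gives `T(x)* T(y) = T(1)* T(x*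
  -- y)`. Choosing `d` with `d* d = ‖a‖² - a* a`, positivity of `T(d)* T(d)` yields `T(a)* T(a) ≤
  -- ‖a‖² T(1)* T(1)`.
  have hbound : ∀ (a : A) (p : A × C →₀ ℂ),
      ‖Finsupp.linearCombination ℂ (fun p : A × C => ψ (a * p.1) * p.2) p‖ ≤
        ‖a‖ * ‖Finsupp.linearCombination ℂ (fun p : A × C => ψ p.1 * p.2) p‖ := by
    intro a p
    let act : Unitization ℂ A → A → A := fun x b => x.fst • b + x.snd * b
    have hact : ∀ x b, (act x b : Unitization ℂ A) = x * b := by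
      intro x b
      ext <;> simp [act]
    let T : Unitization ℂ A → C := fun x => ∑ i ∈ p.support, p i • (ψ (act x i.1) * i.2)
    have hact_key : ∀ (a b : A) (x : Unitization ℂ A),
        star (ψ (act x a)) * ψ b = star (ψ a) * ψ (act (star x) b) := by
      intro a b x
      simp only [act, map_add, map_smul, star_add, star_smul, ← hstar, star_mul, add_mul, mul_add,
        smul_mul_assoc, mul_smul_comm, Unitization.fst_star, Unitization.snd_star, hkey]
    have hact_mul : ∀ x y b, act x (act y b) = act (x * y) b := by
      intro x y b
      apply Unitization.inr_injective (R := ℂ)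
      rw [hact, hact, hact, mul_assoc]
    have hT : ∀ x y, star (T x) * T y = star (T 1) * T (star x * y) := by
      intro x y
      simp only [T, star_sum, Finset.sum_mul_sum, star_smul, star_mul, smul_mul_smul_comm]
      refine Finset.sum_congr rfl fun i _ => Finset.sum_congr rfl fun j _ => ?_
      rw [mul_assoc, ← mul_assoc (star (ψ _)), hact_key, hact_mul, mul_assoc, ← mul_assoc (star _)]
      simp [act]
    have hTs : ∀ (s : ℝ) x, T (algebraMap ℝ _ s - x) = s • T 1 - T x := by
      intro s x
      simp only [T, Finset.smul_sum, ← Finset.sum_sub_distrib]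
      refine Finset.sum_congr rfl fun i _ => ?_
      have : act (algebraMap ℝ _ s - x) i.1 = (s : ℂ) • act 1 i.1 - act x i.1 := by
        apply Unitization.inr_injective (R := ℂ)
        rw [hact, Unitization.inr_sub, Unitization.inr_smul, hact, hact, sub_mul, one_mul,
          ← Algebra.smul_def, Complex.coe_smul]
      rw [this, map_sub, map_smul, sub_mul, smul_sub, smul_mul_assoc, ← Complex.coe_smul,
        smul_comm (p i)]
    let _ : PartialOrder (Unitization ℂ A) := CStarAlgebra.spectralOrder _
    let _ : StarOrderedRing (Unitization ℂ A) := CStarAlgebra.spectralOrderedRing _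
    let _ : PartialOrder C := CStarAlgebra.spectralOrder _
    let _ : StarOrderedRing C := CStarAlgebra.spectralOrderedRing _
    have hle : 0 ≤ algebraMap ℝ (Unitization ℂ A) (‖a‖ ^ 2) - star (a : Unitization ℂ A) * a := by
      have := IsSelfAdjoint.le_algebraMap_norm_self
        (IsSelfAdjoint.star_mul_self (a : Unitization ℂ A))
      rw [CStarRing.norm_star_mul_self, Unitization.norm_inr, ← sq] at this
      exact sub_nonneg.2 this
    obtain ⟨d, hd⟩ := CStarAlgebra.nonneg_iff_eq_star_mul_self.1 hle
    have h1 : star (T a) * T a ≤ ‖a‖ ^ 2 • (star (T 1) * T 1) := by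
      have h2 : star (T d) * T d = ‖a‖ ^ 2 • (star (T 1) * T 1) - star (T a) * T a := by
        rw [hT, ← hd, hTs, hT a, mul_sub, mul_smul_comm]
      exact sub_nonneg.1 (h2 ▸ star_mul_self_nonneg (T d))
    have h2 := CStarAlgebra.norm_le_norm_of_nonneg_of_le (star_mul_self_nonneg _) h1
    rw [norm_smul, CStarRing.norm_star_mul_self, CStarRing.norm_star_mul_self,
      Real.norm_of_nonneg (by positivity)] at h2
    have h3 : ‖T a‖ ≤ ‖a‖ * ‖T 1‖ :=
      abs_le_of_sq_le_sq' (by nlinarith) (by positivity) |>.2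
    have hTa : T a = Finsupp.linearCombination ℂ (fun p : A × C => ψ (a * p.1) * p.2) p := by
      simp [T, act, Finsupp.linearCombination_apply, Finsupp.sum]
    have hT1 : T 1 = Finsupp.linearCombination ℂ (fun p : A × C => ψ p.1 * p.2) p := by
      simp [T, act, Finsupp.linearCombination_apply, Finsupp.sum]
    rwa [hTa, hT1] at h3
  have hex : ∀ a : A, ∃ m : 𝓜(ℂ, C), (∀ b c, m.fst (ψ b * c) = ψ (a * b) * c) ∧
      ∀ b c, (star m).fst (ψ b * c) = ψ (star a * b) * c := by
    intro a
    obtain ⟨m, -, h1, h2⟩ := DoubleCentralizer.exists_of_dense_span hd (norm_nonneg a)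
      (hbound a) ((norm_star a) ▸ hbound (star a)) (fun i j => by
        simp only [star_mul, star_star, ← hstar]
        rw [mul_assoc, ← mul_assoc _ (ψ j.1), hkey, mul_assoc, mul_assoc])
    exact ⟨m, fun b c => h1 (b, c), fun b c => h2 (b, c)⟩
  choose m hm hm' using hex
  refine ⟨{ toFun := m, map_smul' := ?_, map_zero' := ?_, map_add' := ?_, map_mul' := ?_,
            map_star' := ?_ }, hm⟩
  · refine fun k a => DoubleCentralizer.ext_of_dense_span hd fun i => ?_
    simp [hm, smul_mul_assoc]
  · refine DoubleCentralizer.ext_of_dense_span hd fun i => ?_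
    simp [hm]
  · refine fun a b => DoubleCentralizer.ext_of_dense_span hd fun i => ?_
    simp [hm, add_mul]
  · refine fun a b => DoubleCentralizer.ext_of_dense_span hd fun i => ?_
    simp [hm, mul_assoc]
  · refine fun a => DoubleCentralizer.ext_of_dense_span hd fun i => ?_
    rw [hm, hm']

/-- The positive multiplier `h` of `C` determined by `h ψ (a b) c = ψ (a) ψ (b) c`. -/
theorem exists_nonneg_multiplier [PartialOrder A] [StarOrderedRing A]
    (hstar : ∀ a, ψ (star a) = star (ψ a))
    (hkey : ∀ a b c, ψ (a * b) * ψ c = ψ a * ψ (b * c))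
    (hd : Dense (Submodule.span ℂ (Set.range fun p : A × C => ψ p.1 * p.2) : Set C))
    (hpos : ∀ e, 0 ≤ e → ‖e‖ ≤ 1 → ∀ x, ‖(‖ψ‖ : ℂ) • x - ψ e * x‖ ≤ ‖ψ‖ * ‖x‖) :
    ∃ h : 𝓜(ℂ, C), 0 ≤ h ∧ ‖h‖ ≤ ‖ψ‖ ∧ ∀ a b c, h.fst (ψ (a * b) * c) = ψ a * (ψ b * c) := by
  have hd' := dense_span_apply_mul_mul hd
  set u : A × A × C → C := fun p => ψ (p.1 * p.2.1) * p.2.2 with hu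
  set v : A × A × C → C := fun p => ψ p.1 * (ψ p.2.1 * p.2.2) with hv
  have hl := CStarAlgebra.increasingApproximateUnit A
  set l := CStarAlgebra.approximateUnit A
  have := hl.neBot
  -- By `hkey`, `ψ(e) ψ(a b) c = ψ(e a) ψ(b) c`, which tends to `ψ(a) ψ(b) c`. Thus `h` is the limit
  -- of left multiplications by `ψ e` on the span, and inherits their bounds.
  have hlim : ∀ p : A × A × C →₀ ℂ, Tendsto (fun e => ψ e * Finsupp.linearCombination ℂ u p) l
      (𝓝 (Finsupp.linearCombination ℂ v p)) := by
    intro p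
    induction p using Finsupp.induction_linear with
    | zero => simp
    | add p q hp hq => simpa only [map_add, mul_add] using hp.add hq
    | single i k =>
      simp only [Finsupp.linearCombination_single, mul_smul_comm]
      refine Tendsto.const_smul ?_ k
      refine (((ψ.continuous.tendsto _).comp (hl.tendsto_mul_right i.1)).mul_const _).congr
        fun e => ?_
      simp only [Function.comp_apply, hu]
      rw [← mul_assoc, hkey, mul_assoc]
  have hbound : ∀ p : A × A × C →₀ ℂ, ‖Finsupp.linearCombination ℂ v p‖ ≤
      ‖ψ‖ * ‖Finsupp.linearCombination ℂ u p‖ := by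
    intro p
    refine le_of_tendsto (hlim p).norm ?_
    filter_upwards [hl.eventually_norm] with e he
    refine (norm_mul_le _ _).trans ?_
    gcongr
    exact (ψ.le_opNorm e).trans (mul_le_of_le_one_right (norm_nonneg _) he)
  -- The same family `v` serves for `h` and for its adjoint, which is what makes `h` self-adjoint.
  obtain ⟨h, hn, h1, h2⟩ := DoubleCentralizer.exists_of_dense_span hd' (norm_nonneg ψ)
    hbound hbound (fun i j => by
      have h1 : ψ (star i.2.1) * ψ (star i.1) * ψ (j.1 * j.2.1) =
          ψ (star i.2.1 * star i.1) * ψ j.1 * ψ j.2.1 := by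
        rw [mul_assoc, ← hkey, ← mul_assoc, ← hkey]
      simp only [hu, hv, star_mul, ← hstar, ← mul_assoc]
      simp only [mul_assoc (star i.2.2), h1])
  have hsa : IsSelfAdjoint h := DoubleCentralizer.ext_of_dense_span hd' fun i => by rw [h2, h1]
  refine ⟨h, ?_, hn, fun a b c => h1 (a, b, c)⟩
  -- It remains to see that `‖ψ‖ - h` has norm at most `‖ψ‖`; on the dense span this is the limit of
  -- `hpos` along positive contractions `e`.
  refine CStarAlgebra.nonneg_of_norm_algebraMap_sub_le hsa hn ?_
  rw [← DoubleCentralizer.norm_fst]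
  refine ContinuousLinearMap.opNorm_le_bound _ (norm_nonneg _) fun x => ?_
  have hx : ∀ x : C, (algebraMap ℝ 𝓜(ℂ, C) ‖ψ‖ - h).fst x = (‖ψ‖ : ℂ) • x - h.fst x := by
    intro x
    rw [DoubleCentralizer.sub_fst, sub_apply]
    rfl
  refine hd'.induction (P := fun x => ‖(algebraMap ℝ 𝓜(ℂ, C) ‖ψ‖ - h).fst x‖ ≤ ‖ψ‖ * ‖x‖)
    (fun x hx' => ?_) (isClosed_le (by fun_prop) (by fun_prop)) x
  rw [SetLike.mem_coe, ← Finsupp.range_linearCombination] at hx'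
  obtain ⟨p, rfl⟩ := hx'
  have hhp : h.fst (Finsupp.linearCombination ℂ u p) = Finsupp.linearCombination ℂ v p := by
    induction p using Finsupp.induction_linear with
    | zero => simp
    | add p q hp hq => simp only [map_add, hp, hq]
    | single i k => simp [h1]
  rw [hx, hhp]
  refine le_of_tendsto (tendsto_const_nhds.sub (hlim p)).norm ?_
  filter_upwards [hl.eventually_norm, hl.eventually_nonneg] with e he he0
  exact hpos e he0 he _

end Construction

/-- For a generator `ψ a`, both products send `ψ(b b') c` to `ψ(a) ψ(b) ψ(b') c`, one of them via
`ψ(a) ψ(b b') = ψ(a b) ψ(b')`. The commutant of `h` is a closed subalgebra, stable under `star`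
because `h` is self-adjoint. -/
theorem commute_coe_of_apply_eq {A C : Type*} [NonUnitalCStarAlgebra A] [NonUnitalCStarAlgebra C]
    {ψ : A →L[ℂ] C} (hstar : ∀ a, ψ (star a) = star (ψ a))
    (hkey : ∀ a b c, ψ (a * b) * ψ c = ψ a * ψ (b * c))
    (hgen : Dense (NonUnitalStarAlgebra.adjoin ℂ (Set.range ψ) : Set C)) {h : 𝓜(ℂ, C)}
    (hsa : IsSelfAdjoint h) (hh : ∀ a b c, h.fst (ψ (a * b) * c) = ψ a * (ψ b * c)) (c : C) :
    Commute h (DoubleCentralizer.coe ℂ c) := by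
  have hd := dense_span_apply_mul_mul (dense_span_apply_mul hstar hgen)
  change Commute h (DoubleCentralizer.coeHom (𝕜 := ℂ) c)
  have hcont : Continuous (DoubleCentralizer.coeHom (𝕜 := ℂ) (A := C)) := map_continuous _
  refine hgen.induction (P := fun c => Commute h (DoubleCentralizer.coeHom (𝕜 := ℂ) c))
    (fun c hc => ?_) (isClosed_eq (by fun_prop) (by fun_prop)) c
  induction hc using NonUnitalStarAlgebra.adjoin_induction with
  | mem c hc =>
    obtain ⟨a, rfl⟩ := hc
    refine DoubleCentralizer.ext_of_dense_span hd fun i => ?_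
    change h.fst (ψ a * (ψ (i.1 * i.2.1) * i.2.2)) = ψ a * h.fst (ψ (i.1 * i.2.1) * i.2.2)
    rw [hh, ← mul_assoc, ← hkey, mul_assoc, hh]
  | add x y _ _ hx hy => rw [map_add]; exact hx.add_right hy
  | zero => rw [map_zero]; exact Commute.zero_right h
  | mul x y _ _ hx hy => rw [map_mul]; exact hx.mul_right hy
  | smul k x _ hx => rw [map_smul]; exact hx.smul_right k
  | star x _ hx =>
    rw [map_star]
    simpa [hsa.star_eq] using hx.star_star

/-! ### Corestriction to the generated C⋆-algebra -/

section CodRestrict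

variable {A B : Type*} [NonUnitalCStarAlgebra A] [NonUnitalCStarAlgebra B]

/-- A bounded linear map, as a map into the C⋆-algebra generated by its image. -/
noncomputable def codRestrictCstarGenerated (T : A →L[ℂ] B) :
    A →L[ℂ] cstarGenerated (Set.range T) :=
  LinearMap.mkContinuous
    { toFun := fun a => ⟨T a, subset_cstarGenerated _ ⟨a, rfl⟩⟩
      map_add' := fun x y => Subtype.ext (map_add T x y)
      map_smul' := fun k x => Subtype.ext (map_smul T k x) } ‖T‖
    (fun a => T.le_opNorm a)

theorem norm_codRestrictCstarGenerated (T : A →L[ℂ] B) : ‖codRestrictCstarGenerated T‖ = ‖T‖ :=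
  le_antisymm (LinearMap.mkContinuous_norm_le _ (norm_nonneg T) _)
    (T.opNorm_le_bound (norm_nonneg _) fun a => (codRestrictCstarGenerated T).le_opNorm a)

theorem dense_adjoin_range_codRestrict (T : A →L[ℂ] B) :
    Dense (NonUnitalStarAlgebra.adjoin ℂ (Set.range (codRestrictCstarGenerated T)) :
      Set (cstarGenerated (Set.range T))) := by
  intro c
  rw [closure_subtype]
  refine closure_mono ?_ (show (c : B) ∈ closure (NonUnitalStarAlgebra.adjoin ℂ (Set.range T) :
    Set B) from c.2)
  have : NonUnitalStarAlgebra.adjoin ℂ (Set.range T) ≤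
      (NonUnitalStarAlgebra.adjoin ℂ (Set.range (codRestrictCstarGenerated T))).map
        (NonUnitalStarSubalgebraClass.subtype (cstarGenerated (Set.range T))) := by
    refine NonUnitalStarAlgebra.adjoin_le ?_
    rintro _ ⟨a, rfl⟩
    exact ⟨codRestrictCstarGenerated T a, NonUnitalStarAlgebra.subset_adjoin ℂ _ ⟨a, rfl⟩, rfl⟩
  exact this

end CodRestrict

/-! ### The structure theorem -/

theorem mainTheorem12 {G : Type*} [Group G] [TopologicalSpace G] [IsTopologicalGroup G]
    {A : Type*} [NonUnitalCStarAlgebra A] [PartialOrder A] [StarOrderedRing A]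
    {B : Type*} [NonUnitalCStarAlgebra B] [PartialOrder B] [StarOrderedRing B]
    (α : G →* (A ≃⋆ₐ[ℂ] A)) (hα : ∀ a : A, Continuous fun g : G => α g a)
    (β : G →* (B ≃⋆ₐ[ℂ] B)) (hβ : ∀ b : B, Continuous fun g : G => β g b)
    (φ : A →CP B) (hφ : ∀ a : A, ‖φ a‖ ≤ ‖a‖)
    (hφ₀ : ∀ a b : A, 0 ≤ a → 0 ≤ b → a * b = 0 → φ a * φ b = 0)
    (hφG : ∀ (g : G) (a : A), φ (α g a) = β g (φ a)) :
    ∃ γ : G →* (𝓜(ℂ, cstarGenerated (Set.range φ)) ≃⋆ₐ[ℂ] 𝓜(ℂ, cstarGenerated (Set.range φ))),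
      (∀ (g : G) (m : 𝓜(ℂ, cstarGenerated (Set.range φ))),
        multiplierToBidual (cstarGenerated (Set.range φ)) (γ g m) =
          bidualMap (autToCLM (β g)) (multiplierToBidual (cstarGenerated (Set.range φ)) m)) ∧
      ∃ (h : 𝓜(ℂ, cstarGenerated (Set.range φ)))
        (π : A →⋆ₙₐ[ℂ] 𝓜(ℂ, cstarGenerated (Set.range φ))),
        0 ≤ h ∧
        (∀ g : G, γ g h = h) ∧
        (∀ c : cstarGenerated (Set.range φ),
          h * DoubleCentralizer.coe ℂ c = DoubleCentralizer.coe ℂ c * h) ∧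
        ‖h‖ = ‖cpcToCLM φ hφ‖ ∧
        (∀ a : A, π a * h = h * π a) ∧
        Dense (Submodule.span ℂ {x : cstarGenerated (Set.range φ) |
          ∃ (a : A) (c : cstarGenerated (Set.range φ)), x = (π a).fst c} :
            Set (cstarGenerated (Set.range φ))) ∧
        (∀ (g : G) (a : A), γ g (π a) = π (α g a)) ∧
        ∀ a : A,
          DoubleCentralizer.coe ℂ
            (⟨φ a, subset_cstarGenerated _ ⟨a, rfl⟩⟩ : cstarGenerated (Set.range φ)) =
          h * π a := by

  let T : A →L[ℂ] B := cpcToCLM φ hφ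
  let ψ : A →L[ℂ] cstarGenerated (Set.range φ) := codRestrictCstarGenerated T
  have hψn : ‖ψ‖ = ‖cpcToCLM φ hφ‖ := norm_codRestrictCstarGenerated T
  have hstar : ∀ a, ψ (star a) = star (ψ a) := fun a => Subtype.ext (φ.apply_star a)
  have hkey : ∀ a b c, ψ (a * b) * ψ c = ψ a * ψ (b * c) := fun a b c =>
    Subtype.ext (CompletelyPositiveMap.apply_mul_mul_apply hφ₀ a b c)
  have hgen : Dense (NonUnitalStarAlgebra.adjoin ℂ (Set.range ψ) :
      Set (cstarGenerated (Set.range φ))) := dense_adjoin_range_codRestrict T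
  have hd := dense_span_apply_mul hstar hgen
  have hd' := dense_span_apply_mul_mul hd
  have hpos : ∀ e, 0 ≤ e → ‖e‖ ≤ 1 → ∀ x, ‖(‖ψ‖ : ℂ) • x - ψ e * x‖ ≤ ‖ψ‖ * ‖x‖ :=
    fun e he he1 x => norm_smul_sub_mul_le_of_nonneg (φ.apply_nonneg he)
      ((ψ.le_opNorm e).trans (mul_le_of_le_one_right (norm_nonneg _) he1)) (x : B)
  obtain ⟨h, h0, hn, hh⟩ := exists_nonneg_multiplier hstar hkey hd hpos
  obtain ⟨π, hπ⟩ := exists_starAlgHom_multiplier hstar hkey hd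
  have hβφ : ∀ g, ∀ s ∈ Set.range φ, β g s ∈ Set.range φ := by
    rintro g _ ⟨a, rfl⟩
    exact ⟨α g a, hφG g a⟩
  let σ := restrictAut β (Set.range φ) hβφ
  have hσψ : ∀ g a, σ g (ψ a) = ψ (α g a) := fun g a => Subtype.ext (hφG g a).symm
  have hσσ : ∀ g c, σ g (σ g⁻¹ c) = c := fun g c => by
    rw [← StarAlgEquiv.mul_apply, ← map_mul, mul_inv_cancel, map_one, StarAlgEquiv.one_apply]
  have hαα : ∀ g a, α g (α g⁻¹ a) = a := fun g a => by
    rw [← StarAlgEquiv.mul_apply, ← map_mul, mul_inv_cancel, map_one, StarAlgEquiv.one_apply]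
  -- On spanning vectors, `h π(a) ψ(b) c = h ψ(a b) c = ψ(a) ψ(b) c`.
  have hfac : ∀ a, DoubleCentralizer.coe ℂ (ψ a) = h * π a := fun a =>
    DoubleCentralizer.ext_of_dense_span hd fun i => by
      change ψ a * (ψ i.1 * i.2) = h.fst ((π a).fst (ψ i.1 * i.2))
      rw [hπ, hh]
  have hcomm := commute_coe_of_apply_eq hstar hkey hgen (.of_nonneg h0) hh
  refine ⟨DoubleCentralizer.autHom.comp σ, multiplierToBidual_autHom β _ hβφ, h, π, h0, ?_,
    fun c => hcomm c, le_antisymm (hn.trans_eq hψn) ?_, fun a => ?_, ?_, fun g a => ?_, hfac⟩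
  · refine fun g => DoubleCentralizer.ext_of_dense_span hd' fun i => ?_
    change σ g (h.fst ((σ g)⁻¹ _)) = _
    rw [← map_inv, map_mul, hσψ, map_mul (α g⁻¹), hh, hh, map_mul (σ g), map_mul (σ g), hσψ, hσψ, hσσ,
      hαα, hαα]
  -- The bound `‖φ‖ ≤ ‖h‖` comes from the factorization `φ = h π`, since `π` is contractive as a
  -- ⋆-homomorphism.
  · rw [← hψn]
    refine ψ.opNorm_le_bound (norm_nonneg h) fun a => ?_
    calc ‖ψ a‖ = ‖DoubleCentralizer.coe ℂ (ψ a)‖ := by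
          rw [← DoubleCentralizer.norm_fst, DoubleCentralizer.coe_fst,
            ContinuousLinearMap.opNorm_mul_apply]
      _ = ‖h * π a‖ := by rw [hfac]
      _ ≤ ‖h‖ * ‖π a‖ := norm_mul_le _ _
      _ ≤ ‖h‖ * ‖a‖ := by
        gcongr
        exact NonUnitalStarAlgHom.norm_apply_le (F := A →⋆ₙₐ[ℂ] 𝓜(ℂ, _)) π a
  · refine DoubleCentralizer.ext_of_dense_span hd' fun i => ?_
    change (π a).fst (h.fst _) = h.fst ((π a).fst _)
    rw [hh, hπ, hπ, ← mul_assoc a, hh]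
  -- Non-degeneracy: each spanning vector `ψ(a b) c` equals `π(a) (ψ(b) c)`.
  · refine hd'.mono (Submodule.span_mono ?_)
    rintro _ ⟨i, rfl⟩
    exact ⟨i.1, ψ i.2.1 * i.2.2, (hπ _ _ _).symm⟩
  · refine DoubleCentralizer.ext_of_dense_span hd fun i => ?_
    change σ g ((π a).fst ((σ g)⁻¹ _)) = _
    rw [← map_inv, map_mul, hσψ, hπ, hπ, map_mul (σ g), hσψ, map_mul (α g), hσσ, hαα]
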